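/- **Setting.** Let $m,d\ge 0$ and $n\ge 1$ be integers. Let $K_1,\dots,K_m\in\mathbb{R}^{d\times d}$ be symmetric positive semidefinite matrices such that $K(x)=\sum_{j=1}^m x_jK_j$ is positive definite whenever all components of $x\in\mathbb{R}^m$ are positive. Let $Q\in\mathbb{R}^{d\times n}$, let $l\in\mathbb{R}^m$ have positive components, and let $V_0>0$ and $x_{\min}>0$. Put $$S=\{x\in\mathbb{R}^m:\ l^{\mathrm T}x\le V_0,\ x_j\ge x_{\min}\ (j=1,\dots,m)\},\qquad A(x)=Q^{\mathrm T}K(x)^{-1}Q,$$ let $\lambda_1(X)\ge\dots\ge\lambda_n(X)$ be the eigenvalues of a symmetric matrix $X\in\mathbb{R}^{n\times n}$, and define, for $x$ with positive components, $f(x)=f_0(x)=\lambda_1(A(x))$ and $$f_\mu(x)=\mu\log\Big(\sum_{i=1}^n\exp\big(\lambda_i(A(x))/\mu\big)\Big)-\mu\log n\qquad(\mu>0).$$ **Proposition.** The set $S$ is compact, and: 1. For every $\mu>0$, $f_\mu$ is convex on $S$ and continuously differentiable in a neighbourhood of every point of $S$. 2. There are constants $L,L'>0$, independent of $\mu$,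 such that for every $\mu>0$ and all $x,y\in S$, $\|\nabla f_\mu(x)-\nabla f_\mu(y)\|\le (L'+L/\mu)\|x-y\|$ (Euclidean norms). 3. For all $x\in S$ and $\mu_1\ge\mu_2\ge 0$, $0\le f_{\mu_2}(x)-f_{\mu_1}(x)\le(\log n)(\mu_1-\mu_2)$. Consequently, if $S$ is nonempty, then for every $\beta>0$ with $\beta\ge\log n$ (in particular for $\beta=\log n$ if $n\ge2$) the following assumption holds with this $\beta$: $S$ is nonempty, closed and convex; $f$ is convex on $S$ and attains its minimum over $S$; for every $\mu>0$, $f_\mu$ is convex and continuously differentiable on $S$; there are $L>0$ and $L'\ge0$, independent of $\mu$, such that $\nabla f_\mu$ is $(L'+L/\mu)$-Lipschitz continuous on $S$ for every $\mu>0$; and $0\le f_{\mu_2}(x)-f_{\mu_1}(x)\le\beta(\mu_1-\mu_2)$ for all $x\in S$ and $\mu_1\ge\mu_2\ge0$, where $f_0=f$. -/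

import Mathlib

open scoped Matrix Gradient

noncomputable section

/-- `sortedEigenvalue hA i` is the `i`-th largest eigenvalue (with multiplicity, counting
from `0`) of the real symmetric matrix `A`. -/
def sortedEigenvalue {n : ℕ} {A : Matrix (Fin n) (Fin n) ℝ} (hA : A.IsHermitian)
    (i : Fin n) : ℝ :=
  hA.eigenvalues₀ (Fin.cast (Fintype.card_fin n).symm i)

/-- The data of a robust compliance minimization problem of a truss with `m` bars, `d`
displacement degrees of freedom and an `n`-dimensional uncertain load. -/
structure RobustTruss (m d n : ℕ) where
  /-- The constant matrices `K_j` of the global stiffness matrix `K(x) = ∑ j, x_j K_j`. -/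
  barStiffness : Fin m → Matrix (Fin d) (Fin d) ℝ
  /-- The matrix `Q` of the uncertain load `Q f`, `‖f‖ = 1`. -/
  load : Matrix (Fin d) (Fin n) ℝ
  /-- The lengths of the bars. -/
  length : Fin m → ℝ
  /-- The upper limit of the volume. -/
  maxVolume : ℝ
  /-- The lower limit of the cross-sectional areas. -/
  minArea : ℝ
  barStiffness_posSemidef : ∀ j, (barStiffness j).PosSemidef
  /-- `K(x)` is positive definite when every component of `x` is positive. -/
  posDef_of_pos : ∀ x : Fin m → ℝ, (∀ j, 0 < x j) → (∑ j, x j • barStiffness j).PosDef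
  length_pos : ∀ j, 0 < length j
  maxVolume_pos : 0 < maxVolume
  minArea_pos : 0 < minArea

namespace RobustTruss

variable {m d n : ℕ} (T : RobustTruss m d n)

/-- The global stiffness matrix `K(x)`. -/
def stiffness (x : EuclideanSpace ℝ (Fin m)) : Matrix (Fin d) (Fin d) ℝ :=
  ∑ j, x j • T.barStiffness j

/-- The matrix `A(x) = Qᵀ K(x)⁻¹ Q`. -/
def complianceMatrix (x : EuclideanSpace ℝ (Fin m)) : Matrix (Fin n) (Fin n) ℝ :=
  T.loadᵀ * (T.stiffness x)⁻¹ * T.load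

theorem stiffness_isHermitian (x : EuclideanSpace ℝ (Fin m)) :
    (T.stiffness x).IsHermitian := by
  have h : ∀ j, (T.barStiffness j)ᵀ = T.barStiffness j := fun j => by
    simpa [Matrix.IsHermitian, Matrix.conjTranspose_eq_transpose_of_trivial] using
      (T.barStiffness_posSemidef j).isHermitian
  simp [Matrix.IsHermitian, stiffness, Matrix.conjTranspose_eq_transpose_of_trivial,
    Matrix.transpose_sum, h]

theorem complianceMatrix_isHermitian (x : EuclideanSpace ℝ (Fin m)) :
    (T.complianceMatrix x).IsHermitian := by
  have h := Matrix.isHermitian_conjTranspose_mul_mul T.load (T.stiffness_isHermitian x).inv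
  simpa [complianceMatrix, Matrix.conjTranspose_eq_transpose_of_trivial] using h

/-- The feasible set `{x | lᵀ x ≤ V₀, x_min ≤ x_j for all j}`. -/
def feasibleSet : Set (EuclideanSpace ℝ (Fin m)) :=
  {x | ∑ j, T.length j * x j ≤ T.maxVolume ∧ ∀ j, T.minArea ≤ x j}

/-- The robust compliance `λ₁(A(x))`. -/
def objective [NeZero n] (x : EuclideanSpace ℝ (Fin m)) : ℝ :=
  sortedEigenvalue (T.complianceMatrix_isHermitian x) 0

/-- The smooth approximation `f_μ` of the robust compliance, with `f_0 = f`. -/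
def smoothing [NeZero n] (μ : ℝ) (x : EuclideanSpace ℝ (Fin m)) : ℝ :=
  if μ = 0 then T.objective x
  else
    μ * Real.log (∑ i : Fin n,
        Real.exp (sortedEigenvalue (T.complianceMatrix_isHermitian x) i / μ))
      - μ * Real.log n

end RobustTruss

/-- The standing assumption on the problem of minimizing `f` over `S` with a family `F μ`
(`μ > 0`) of smooth approximations of `f`, where `F 0 = f` on `S` and `β` is the constant of
the approximation bound. The functions are total on `ℝᵐ`, but only their values near `S`
matter. -/
structure SmoothingAssumption {m : ℕ} (S : Set (EuclideanSpace ℝ (Fin m)))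
    (f : EuclideanSpace ℝ (Fin m) → ℝ) (F : ℝ → EuclideanSpace ℝ (Fin m) → ℝ)
    (β : ℝ) : Prop where
  nonempty : S.Nonempty
  isClosed : IsClosed S
  convex : Convex ℝ S
  convexOn : ConvexOn ℝ S f
  exists_optimal : ∃ x ∈ S, IsMinOn f S x
  approx_zero : ∀ x ∈ S, F 0 x = f x
  approx_convexOn : ∀ μ : ℝ, 0 < μ → ConvexOn ℝ S (F μ)
  approx_contDiffAt : ∀ μ : ℝ, 0 < μ → ∀ x ∈ S, ContDiffAt ℝ 1 (F μ) x
  approx_lipschitz : ∃ L L' : ℝ, 0 < L ∧ 0 ≤ L' ∧ ∀ μ : ℝ, 0 < μ →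
    ∀ x ∈ S, ∀ y ∈ S, ‖∇ (F μ) x - ∇ (F μ) y‖ ≤ (L' + L / μ) * ‖x - y‖
  bound_pos : 0 < β
  approx_bound : ∀ x ∈ S, ∀ μ₁ μ₂ : ℝ, μ₂ ≤ μ₁ → 0 ≤ μ₂ →
    0 ≤ F μ₂ x - F μ₁ x ∧ F μ₂ x - F μ₁ x ≤ β * (μ₁ - μ₂)

end

/-!
Write `E(X) = log tr exp X` for a symmetric matrix `X` and `ρ(X) = exp X / tr exp X` for its Gibbs
state. Then `f_μ(x) = μ E(A(x) / μ) - μ log n`, and everything follows from two facts on `E`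
and `ρ`.

The first is the subgradient inequality `E(X) + tr (ρ(X) (Y - X)) ≤ E(Y)`
(`Matrix.IsHermitian.logTraceExp_add_trace_gibbs_mul_le`), a consequence of Klein's inequality
`Matrix.IsHermitian.trace_exp_add_trace_mul_le`. As `ρ(X)` is positive semidefinite and
`K ↦ K⁻¹` is matrix convex (`Matrix.PosDef.posSemidef_convexCombo_inv_sub`), it gives the convexity
of `f_μ`. It also identifies the derivative of `f_μ`, so that the derivative of a trace of
noncommuting exponentials need not be computed: `f_μ` is smooth as a composition of analytic maps,
and `y ↦ f_μ(y) - tr (ρ(A(x) / μ) A(y))` has a minimum at `y = x`, whence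
`f_μ'(x) h = tr (ρ(A(x) / μ) A'(x) h)` (`RobustTruss.fderiv_smoothing_apply`).

The second is that `ρ` is globally Lipschitz (`Matrix.IsHermitian.norm_gibbs_sub_gibbs_le`). Indeed
`ρ(X) = exp (X - E(X) 1)` is the exponential of a matrix with nonpositive eigenvalues; between two
such matrices the mean value inequality along `s ↦ exp (s Y) exp ((1 - s) X)` shows that `exp` is
1-Lipschitz, and `E` is Lipschitz by the subgradient inequality. Since `A` is smooth on a
neighbourhood of the compact convex feasible set, `A` and `A'` are Lipschitz there and `A'` is
bounded, which yields the Lipschitz constant `L' + L / μ` of the gradient.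

The dependence on `μ` is a scalar matter: `μ log ∑ exp (λ_i / μ)` is monotone in `μ`
(`logSumExp_mono`), while subtracting `μ log n` makes it antitone by the power mean inequality
(`logSumExp_sub_log_card_anti`). The objective is then a uniform limit of the `f_μ`, hence convex
and continuous on the feasible set, where it attains its minimum.
-/

noncomputable section

open scoped Matrix.Norms.L2Operator

namespace Matrix

variable {ι : Type*} [Fintype ι] [DecidableEq ι]

/-! ### Spectral form of the exponential and Klein's inequality -/

theorem IsHermitian.exp_smul_eq {X : Matrix ι ι ℝ} (hX : X.IsHermitian) (t : ℝ) :
    NormedSpace.exp (t • X) =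
      (hX.eigenvectorUnitary : Matrix ι ι ℝ) *
        diagonal (fun i => Real.exp (t * hX.eigenvalues i)) *
        star (hX.eigenvectorUnitary : Matrix ι ι ℝ) := by
  have hinv : (hX.eigenvectorUnitary : Matrix ι ι ℝ)⁻¹ =
      star (hX.eigenvectorUnitary : Matrix ι ι ℝ) :=
    inv_eq_left_inv (Unitary.coe_star_mul_self hX.eigenvectorUnitary)
  have hU : IsUnit (hX.eigenvectorUnitary : Matrix ι ι ℝ) :=
    IsUnit.of_mul_eq_one _ (Unitary.coe_mul_star_self hX.eigenvectorUnitary)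
  have hspec : t • X = (hX.eigenvectorUnitary : Matrix ι ι ℝ) *
        diagonal (fun i => t * hX.eigenvalues i) *
        (hX.eigenvectorUnitary : Matrix ι ι ℝ)⁻¹ := by
    have hd : diagonal (fun i => t * hX.eigenvalues i) =
        t • diagonal hX.eigenvalues := by
      rw [← diagonal_smul]; rfl
    conv_lhs => rw [hX.spectral_theorem, Unitary.conjStarAlgAut_apply]
    rw [hinv, hd, mul_smul_comm, smul_mul_assoc]
    rfl
  rw [hspec, exp_conj _ _ hU, exp_diagonal, hinv]
  congr 3
  funext i
  rw [Pi.coe_exp, Real.exp_eq_exp_ℝ]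

theorem IsHermitian.exp_eq {X : Matrix ι ι ℝ} (hX : X.IsHermitian) :
    NormedSpace.exp X =
      (hX.eigenvectorUnitary : Matrix ι ι ℝ) *
        diagonal (fun i => Real.exp (hX.eigenvalues i)) *
        star (hX.eigenvectorUnitary : Matrix ι ι ℝ) := by
  simpa using hX.exp_smul_eq 1

theorem IsHermitian.eq_conj_diagonal {X : Matrix ι ι ℝ} (hX : X.IsHermitian) :
    X = (hX.eigenvectorUnitary : Matrix ι ι ℝ) * diagonal hX.eigenvalues *
        star (hX.eigenvectorUnitary : Matrix ι ι ℝ) := by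
  conv_lhs => rw [hX.spectral_theorem, Unitary.conjStarAlgAut_apply]
  rfl

theorem trace_unitary_conj_diagonal (U : unitary (Matrix ι ι ℝ)) (a : ι → ℝ) :
    ((U : Matrix ι ι ℝ) * diagonal a * star (U : Matrix ι ι ℝ)).trace = ∑ i, a i := by
  rw [trace_mul_cycle, Unitary.coe_star_mul_self, one_mul, trace_diagonal]

theorem IsHermitian.trace_exp_smul {X : Matrix ι ι ℝ} (hX : X.IsHermitian) (t : ℝ) :
    (NormedSpace.exp (t • X)).trace = ∑ i, Real.exp (t * hX.eigenvalues i) := by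
  rw [hX.exp_smul_eq, trace_unitary_conj_diagonal]

theorem IsHermitian.trace_exp {X : Matrix ι ι ℝ} (hX : X.IsHermitian) :
    (NormedSpace.exp X).trace = ∑ i, Real.exp (hX.eigenvalues i) := by
  simpa using hX.trace_exp_smul 1

theorem IsHermitian.trace_exp_pos [Nonempty ι] {X : Matrix ι ι ℝ} (hX : X.IsHermitian) :
    0 < (NormedSpace.exp X).trace := by
  rw [hX.trace_exp]
  exact Finset.sum_pos (fun i _ => Real.exp_pos _) Finset.univ_nonempty

/-- The trace of a product of two symmetric matrices in terms of their eigenvalues `a`, `b` and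
the squared entries of the transition matrix between the eigenbases. -/
theorem trace_conj_mul_conj (U V : unitary (Matrix ι ι ℝ)) (a b : ι → ℝ) :
    ((U : Matrix ι ι ℝ) * diagonal a * star (U : Matrix ι ι ℝ) *
      ((V : Matrix ι ι ℝ) * diagonal b * star (V : Matrix ι ι ℝ))).trace =
    ∑ i, ∑ j, (star (U : Matrix ι ι ℝ) * (V : Matrix ι ι ℝ)) i j ^ 2 * (a i * b j) := by
  set W : Matrix ι ι ℝ := star (U : Matrix ι ι ℝ) * (V : Matrix ι ι ℝ) with hW
  have h : ((U : Matrix ι ι ℝ) * diagonal a * star (U : Matrix ι ι ℝ) *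
      ((V : Matrix ι ι ℝ) * diagonal b * star (V : Matrix ι ι ℝ))).trace =
      (diagonal a * W * (diagonal b * star W)).trace := by
    rw [hW, star_mul, star_star]
    calc _ = ((U : Matrix ι ι ℝ) * (diagonal a * star (U : Matrix ι ι ℝ) *
      ((V : Matrix ι ι ℝ) * diagonal b * star (V : Matrix ι ι ℝ)))).trace := by
            simp only [mul_assoc]
      _ = _ := by rw [trace_mul_comm]; simp only [mul_assoc]
  rw [h, trace]
  refine Finset.sum_congr rfl fun i _ => ?_
  rw [diag_apply, mul_apply]
  refine Finset.sum_congr rfl fun j _ => ?_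
  rw [diagonal_mul, diagonal_mul, star_apply, star_trivial]
  ring

/-- **Klein's inequality** for the exponential function: expanded in the eigenbases of `X` and `Y`,
it is the sum, with nonnegative weights, of the scalar tangent line inequalities between the
eigenvalues. -/
theorem IsHermitian.trace_exp_add_trace_mul_le {X Y : Matrix ι ι ℝ} (hX : X.IsHermitian)
    (hY : Y.IsHermitian) :
    (NormedSpace.exp X).trace + (NormedSpace.exp X * (Y - X)).trace ≤
      (NormedSpace.exp Y).trace := by
  set U := hX.eigenvectorUnitary
  set V := hY.eigenvectorUnitary
  set x := hX.eigenvalues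
  set y := hY.eigenvalues
  have one_eq (U : unitary (Matrix ι ι ℝ)) :
      (U : Matrix ι ι ℝ) * diagonal (fun _ => 1) * star (U : Matrix ι ι ℝ) = 1 := by
    rw [diagonal_one, mul_one, Unitary.mul_star_self_of_mem U.2]
  have hX2 : NormedSpace.exp X * X =
      (U : Matrix ι ι ℝ) * diagonal (fun i => Real.exp (x i) * x i) *
        star (U : Matrix ι ι ℝ) := by
    conv_lhs => rw [hX.exp_eq]; rhs; rw [hX.eq_conj_diagonal]
    rw [← diagonal_mul_diagonal]
    calc _ = (U : Matrix ι ι ℝ) * diagonal (fun i => Real.exp (x i)) *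
          (star (U : Matrix ι ι ℝ) * (U : Matrix ι ι ℝ)) * diagonal x *
            star (U : Matrix ι ι ℝ) := by simp only [mul_assoc]; rfl
      _ = _ := by rw [Unitary.coe_star_mul_self, mul_one]; simp only [mul_assoc]
  have e1 := trace_conj_mul_conj U V (fun i => Real.exp (x i)) (fun _ => 1)
  rw [one_eq V, mul_one, ← hX.exp_eq] at e1
  have e2 := trace_conj_mul_conj U V (fun _ => 1) (fun j => Real.exp (y j))
  rw [one_eq U, one_mul, ← hY.exp_eq] at e2
  have e3 := trace_conj_mul_conj U V (fun i => Real.exp (x i) * x i) (fun _ => 1)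
  rw [one_eq V, mul_one, ← hX2] at e3
  have e4 := trace_conj_mul_conj U V (fun i => Real.exp (x i)) y
  rw [← hX.exp_eq, ← hY.eq_conj_diagonal] at e4
  rw [mul_sub, trace_sub, e1, e2, e3, e4, ← Finset.sum_sub_distrib, ← Finset.sum_add_distrib]
  refine Finset.sum_le_sum fun i _ => ?_
  rw [← Finset.sum_sub_distrib, ← Finset.sum_add_distrib]
  refine Finset.sum_le_sum fun j _ => ?_
  rw [← mul_sub, ← mul_add]
  refine mul_le_mul_of_nonneg_left ?_ (sq_nonneg _)
  have h1 := Real.add_one_le_exp (y j - x i)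
  have h2 : Real.exp (x i) * Real.exp (y j - x i) = Real.exp (y j) := by
    rw [← Real.exp_add]; congr 1; ring
  nlinarith [mul_le_mul_of_nonneg_left h1 (Real.exp_pos (x i)).le]

theorem exp_add_smul_one (X : Matrix ι ι ℝ) (c : ℝ) :
    NormedSpace.exp (X + c • (1 : Matrix ι ι ℝ)) = Real.exp c • NormedSpace.exp X := by
  have hc : NormedSpace.exp (c • (1 : Matrix ι ι ℝ)) = Real.exp c • 1 := by
    rw [← Algebra.algebraMap_eq_smul_one, ← NormedSpace.algebraMap_exp_comm,
      ← Real.exp_eq_exp_ℝ, Algebra.algebraMap_eq_smul_one]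
  rw [exp_add_of_commute _ _ ((Commute.one_right X).smul_right c), hc, mul_smul_comm, mul_one]

/-! ### The log-partition function and the Gibbs state -/

/-- The log-partition function `log tr exp X`. -/
def logTraceExp (X : Matrix ι ι ℝ) : ℝ := Real.log (NormedSpace.exp X).trace

/-- The Gibbs state `exp X / tr exp X`, which is the gradient of `logTraceExp` at `X` for the
trace inner product. -/
def gibbs (X : Matrix ι ι ℝ) : Matrix ι ι ℝ :=
  (NormedSpace.exp X).trace⁻¹ • NormedSpace.exp X

theorem isHermitian_add_smul_one {κ : Type*} [DecidableEq κ] {X : Matrix κ κ ℝ}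
    (hX : X.IsHermitian) (c : ℝ) : (X + c • (1 : Matrix κ κ ℝ)).IsHermitian :=
  hX.add (isHermitian_one.smul (star_trivial c))

theorem IsHermitian.trace_gibbs [Nonempty ι] {X : Matrix ι ι ℝ} (hX : X.IsHermitian) :
    (gibbs X).trace = 1 := by
  rw [gibbs, trace_smul, smul_eq_mul, inv_mul_cancel₀ hX.trace_exp_pos.ne']

theorem IsHermitian.gibbs_eq_exp [Nonempty ι] {X : Matrix ι ι ℝ} (hX : X.IsHermitian) :
    gibbs X = NormedSpace.exp (X + (-logTraceExp X) • (1 : Matrix ι ι ℝ)) := by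
  rw [exp_add_smul_one, Real.exp_neg, logTraceExp, Real.exp_log hX.trace_exp_pos, gibbs]

/-- The Peierls–Bogoliubov inequality: the Gibbs state is a subgradient of `logTraceExp`. It is
Klein's inequality for `X` and a shift of `Y` by a scalar matrix that equalizes the traces of the
exponentials. -/
theorem IsHermitian.logTraceExp_add_trace_gibbs_mul_le [Nonempty ι] {X Y : Matrix ι ι ℝ}
    (hX : X.IsHermitian) (hY : Y.IsHermitian) :
    logTraceExp X + (gibbs X * (Y - X)).trace ≤ logTraceExp Y := by
  have hZ := hX.trace_exp_pos
  have h := hX.trace_exp_add_trace_mul_le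
    (isHermitian_add_smul_one hY (logTraceExp X - logTraceExp Y))
  have h1 : (NormedSpace.exp (Y + (logTraceExp X - logTraceExp Y) • (1 : Matrix ι ι ℝ))).trace =
      (NormedSpace.exp X).trace := by
    rw [exp_add_smul_one, trace_smul, smul_eq_mul, Real.exp_sub, logTraceExp, logTraceExp,
      Real.exp_log hX.trace_exp_pos, Real.exp_log hY.trace_exp_pos,
      div_mul_cancel₀ _ hY.trace_exp_pos.ne']
  rw [h1, add_sub_right_comm, mul_add, trace_add, mul_smul_comm, mul_one, trace_smul,
    smul_eq_mul] at h
  have h2 : (gibbs X * (Y - X)).trace =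
      (NormedSpace.exp X).trace⁻¹ * (NormedSpace.exp X * (Y - X)).trace := by
    rw [gibbs, smul_mul_assoc, trace_smul, smul_eq_mul]
  have h3 : (gibbs X * (Y - X)).trace * (NormedSpace.exp X).trace =
      (NormedSpace.exp X * (Y - X)).trace := by
    rw [h2]; field_simp
  have h4 : ((gibbs X * (Y - X)).trace + (logTraceExp X - logTraceExp Y)) *
      (NormedSpace.exp X).trace ≤ 0 := by
    rw [add_mul, h3]; linarith
  have := nonpos_of_mul_nonpos_left h4 hZ
  linarith

theorem IsHermitian.trace_gibbs_mul_nonneg {X M : Matrix ι ι ℝ} (hX : X.IsHermitian)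
    (hM : M.PosSemidef) : 0 ≤ (gibbs X * M).trace := by
  rw [gibbs, smul_mul_assoc, trace_smul, smul_eq_mul]
  refine mul_nonneg ?_ ?_
  · rw [inv_nonneg, hX.trace_exp]
    exact Finset.sum_nonneg fun i _ => (Real.exp_pos _).le
  · have h : (star (hX.eigenvectorUnitary : Matrix ι ι ℝ) *
        M * (hX.eigenvectorUnitary : Matrix ι ι ℝ)).PosSemidef :=
      hM.conjTranspose_mul_mul_same _
    have e : (NormedSpace.exp X * M).trace =
        (diagonal (fun i => Real.exp (hX.eigenvalues i)) *
          (star (hX.eigenvectorUnitary : Matrix ι ι ℝ) * M *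
            (hX.eigenvectorUnitary : Matrix ι ι ℝ))).trace := by
      rw [hX.exp_eq, mul_assoc, mul_assoc, trace_mul_comm, mul_assoc, mul_assoc]
    rw [e, trace]
    refine Finset.sum_nonneg fun i _ => ?_
    rw [diag_apply, diagonal_mul]
    exact mul_nonneg (Real.exp_pos _).le h.diag_nonneg

/-! ### Lipschitz continuity of the Gibbs state -/

theorem IsHermitian.norm_exp_smul_le_one {X : Matrix ι ι ℝ} (hX : X.IsHermitian)
    (htr : (NormedSpace.exp X).trace ≤ 1) {t : ℝ} (ht : 0 ≤ t) :
    ‖NormedSpace.exp (t • X)‖ ≤ 1 := by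
  have hev (i : ι) : hX.eigenvalues i ≤ 0 := by
    rw [← Real.exp_le_one_iff]
    refine le_trans ?_ htr
    rw [hX.trace_exp]
    exact Finset.single_le_sum (f := fun i => Real.exp (hX.eigenvalues i))
      (fun j _ => (Real.exp_pos _).le) (Finset.mem_univ i)
  rw [hX.exp_smul_eq, ← Unitary.coe_star, CStarRing.norm_mul_coe_unitary,
    CStarRing.norm_coe_unitary_mul, l2_opNorm_diagonal,
    pi_norm_le_iff_of_nonneg zero_le_one]
  intro i
  rw [Real.norm_of_nonneg (Real.exp_pos _).le, Real.exp_le_one_iff]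
  exact mul_nonpos_of_nonneg_of_nonpos ht (hev i)

/-- Mean value estimate along `s ↦ exp (s Y) exp ((1 - s) X)`, whose derivative is
`exp (s Y) (Y - X) exp ((1 - s) X)`. -/
theorem IsHermitian.norm_exp_sub_exp_le {X Y : Matrix ι ι ℝ} (hX : X.IsHermitian)
    (hY : Y.IsHermitian) (hXtr : (NormedSpace.exp X).trace ≤ 1)
    (hYtr : (NormedSpace.exp Y).trace ≤ 1) :
    ‖NormedSpace.exp Y - NormedSpace.exp X‖ ≤ ‖Y - X‖ := by
  let f : ℝ → Matrix ι ι ℝ := fun s => NormedSpace.exp (s • Y) * NormedSpace.exp ((1 - s) • X)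
  have hf (s : ℝ) : HasDerivAt f
      (NormedSpace.exp (s • Y) * (Y - X) * NormedSpace.exp ((1 - s) • X)) s := by
    have h1 := hasDerivAt_exp_smul_const Y s
    have h2 := (hasDerivAt_exp_smul_const' X (1 - s)).scomp s ((hasDerivAt_id s).const_sub 1)
    convert! h1.mul h2 using 1
    simp [mul_sub, sub_mul, mul_assoc]
    rfl
  have h := norm_image_sub_le_of_norm_deriv_le_segment_01' (C := ‖Y - X‖)
    (fun s _ => (hf s).hasDerivWithinAt) fun s hs => by
      have a1 := hY.norm_exp_smul_le_one hYtr hs.1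
      have a2 := hX.norm_exp_smul_le_one hXtr (sub_nonneg.mpr hs.2.le)
      calc _ ≤ ‖NormedSpace.exp (s • Y) * (Y - X)‖ * ‖NormedSpace.exp ((1 - s) • X)‖ :=
            norm_mul_le _ _
        _ ≤ ‖NormedSpace.exp (s • Y) * (Y - X)‖ * 1 := by gcongr
        _ ≤ ‖NormedSpace.exp (s • Y)‖ * ‖Y - X‖ := by rw [mul_one]; exact norm_mul_le _ _
        _ ≤ 1 * ‖Y - X‖ := by gcongr
        _ = _ := one_mul _
  simpa [f] using h

/-- The trace as a continuous linear functional on matrices, normed by the `ℓ²` operator norm. -/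
def traceCLM (ι : Type*) [Fintype ι] [DecidableEq ι] : Matrix ι ι ℝ →L[ℝ] ℝ :=
  LinearMap.toContinuousLinearMap (traceLinearMap ι ℝ ℝ)

@[simp]
theorem traceCLM_apply (M : Matrix ι ι ℝ) : traceCLM ι M = M.trace := rfl

theorem abs_trace_mul_le (M N : Matrix ι ι ℝ) :
    |(M * N).trace| ≤ ‖traceCLM ι‖ * ‖M‖ * ‖N‖ := by
  calc |(M * N).trace| = ‖traceCLM ι (M * N)‖ := by rw [traceCLM_apply, Real.norm_eq_abs]
    _ ≤ ‖traceCLM ι‖ * ‖M * N‖ := (traceCLM ι).le_opNorm _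
    _ ≤ ‖traceCLM ι‖ * (‖M‖ * ‖N‖) := by gcongr; exact norm_mul_le _ _
    _ = _ := by ring

theorem IsHermitian.norm_gibbs_le_one [Nonempty ι] {X : Matrix ι ι ℝ} (hX : X.IsHermitian) :
    ‖gibbs X‖ ≤ 1 := by
  have h := hX.trace_gibbs
  rw [hX.gibbs_eq_exp] at h ⊢
  simpa using (isHermitian_add_smul_one hX _).norm_exp_smul_le_one h.le zero_le_one

theorem IsHermitian.abs_logTraceExp_sub_le [Nonempty ι] {X Y : Matrix ι ι ℝ}
    (hX : X.IsHermitian) (hY : Y.IsHermitian) :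
    |logTraceExp Y - logTraceExp X| ≤ ‖traceCLM ι‖ * ‖Y - X‖ := by
  have key {X Y : Matrix ι ι ℝ} (hX : X.IsHermitian) (hY : Y.IsHermitian) :
      logTraceExp X - logTraceExp Y ≤ ‖traceCLM ι‖ * ‖Y - X‖ := by
    have h1 := hX.logTraceExp_add_trace_gibbs_mul_le hY
    have h2 := (abs_le.mp (abs_trace_mul_le (gibbs X) (Y - X))).1
    have h3 : ‖traceCLM ι‖ * ‖gibbs X‖ * ‖Y - X‖ ≤ ‖traceCLM ι‖ * 1 * ‖Y - X‖ := by
      gcongr; exact hX.norm_gibbs_le_one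
    linarith
  rw [abs_sub_le_iff]
  exact ⟨by rw [norm_sub_rev]; exact key hY hX, key hX hY⟩

/-- The Gibbs state is a globally Lipschitz function of a symmetric matrix: it is the exponential
of a shift of the matrix by a scalar, and the shifted exponentials have trace one. -/
theorem IsHermitian.norm_gibbs_sub_gibbs_le [Nonempty ι] {X Y : Matrix ι ι ℝ}
    (hX : X.IsHermitian) (hY : Y.IsHermitian) :
    ‖gibbs Y - gibbs X‖ ≤ (1 + ‖traceCLM ι‖) * ‖Y - X‖ := by
  have h1 := hX.trace_gibbs
  have h2 := hY.trace_gibbs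
  have h3 := hX.abs_logTraceExp_sub_le hY
  rw [hX.gibbs_eq_exp] at h1 ⊢
  rw [hY.gibbs_eq_exp] at h2 ⊢
  refine ((isHermitian_add_smul_one hX _).norm_exp_sub_exp_le (isHermitian_add_smul_one hY _)
    h1.le h2.le).trans ?_
  have e : Y + (-logTraceExp Y) • (1 : Matrix ι ι ℝ) - (X + (-logTraceExp X) • 1) =
      (Y - X) - (logTraceExp Y - logTraceExp X) • (1 : Matrix ι ι ℝ) := by
    rw [sub_smul, neg_smul, neg_smul]; abel
  rw [e]
  calc _ ≤ ‖Y - X‖ + ‖(logTraceExp Y - logTraceExp X) • (1 : Matrix ι ι ℝ)‖ := norm_sub_le _ _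
    _ = ‖Y - X‖ + |logTraceExp Y - logTraceExp X| := by
      rw [norm_smul, CStarRing.norm_one, mul_one, Real.norm_eq_abs]
    _ ≤ ‖Y - X‖ + ‖traceCLM ι‖ * ‖Y - X‖ := by gcongr
    _ = _ := by ring

theorem contDiffAt_logTraceExp {X : Matrix ι ι ℝ} (hX : X.IsHermitian) [Nonempty ι]
    {k : WithTop ℕ∞} : ContDiffAt ℝ k logTraceExp X := by
  have h1 : ContDiffAt ℝ k (NormedSpace.exp : Matrix ι ι ℝ → Matrix ι ι ℝ) X :=
    (NormedSpace.exp_analytic (𝕂 := ℝ) X).contDiffAt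
  exact ((traceCLM ι).contDiff.contDiffAt.comp X h1).log hX.trace_exp_pos.ne'

end Matrix

/-! ### Log-sum-exp as a function of the scale -/

/-- The scaled log-sum-exp function `μ log ∑ exp (a i / μ)`. -/
def logSumExp {ι : Type*} [Fintype ι] (a : ι → ℝ) (μ : ℝ) : ℝ :=
  μ * Real.log (∑ i, Real.exp (a i / μ))

section LogSumExp

variable {ι : Type*} [Fintype ι] [Nonempty ι] (a : ι → ℝ)

theorem sum_exp_pos (b : ι → ℝ) : 0 < ∑ i, Real.exp (b i) :=
  Finset.sum_pos (fun _ _ => Real.exp_pos _) Finset.univ_nonempty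

theorem sum_exp_sub_logSumExp_div {μ : ℝ} (hμ : 0 < μ) (c : ℝ) :
    ∑ i, Real.exp ((a i - (logSumExp a μ - c)) / μ) = Real.exp (c / μ) := by
  have h (i : ι) : Real.exp ((a i - (logSumExp a μ - c)) / μ) =
      Real.exp (a i / μ) * ((∑ i, Real.exp (a i / μ))⁻¹ * Real.exp (c / μ)) := by
    rw [← Real.exp_log (sum_exp_pos fun i => a i / μ), ← Real.exp_neg, ← Real.exp_add,
      ← Real.exp_add, logSumExp]
    congr 1
    field_simp
    ring
  rw [Finset.sum_congr rfl fun i _ => h i, ← Finset.sum_mul, ← mul_assoc,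
    mul_inv_cancel₀ (sum_exp_pos _).ne', one_mul]

theorem logSumExp_le_iff {μ : ℝ} (hμ : 0 < μ) (c : ℝ) :
    logSumExp a μ ≤ c ↔ ∑ i, Real.exp ((a i - c) / μ) ≤ 1 := by
  have h := sum_exp_sub_logSumExp_div a hμ (logSumExp a μ - c)
  rw [sub_sub_cancel] at h
  rw [h, Real.exp_le_one_iff, div_le_iff₀ hμ, zero_mul, sub_nonpos]

theorem le_logSumExp {μ : ℝ} (hμ : 0 < μ) (i : ι) : a i ≤ logSumExp a μ := by
  have h := (logSumExp_le_iff a hμ _).mp le_rfl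
  have h1 := (Finset.single_le_sum (f := fun i => Real.exp ((a i - logSumExp a μ) / μ))
    (fun j _ => (Real.exp_pos _).le) (Finset.mem_univ i)).trans h
  rw [Real.exp_le_one_iff, div_le_iff₀ hμ, zero_mul, sub_nonpos] at h1
  exact h1

theorem logSumExp_le_add_log_card {μ c : ℝ} (hμ : 0 < μ) (hc : ∀ i, a i ≤ c) :
    logSumExp a μ ≤ c + μ * Real.log (Fintype.card ι) := by
  have h : ∑ i, Real.exp (a i / μ) ≤ Fintype.card ι * Real.exp (c / μ) := by
    calc _ ≤ ∑ _i : ι, Real.exp (c / μ) := by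
          gcongr with i; exact hc i
      _ = _ := by simp
  have h1 := Real.log_le_log (sum_exp_pos _) h
  rw [Real.log_mul (by positivity) (Real.exp_pos _).ne', Real.log_exp] at h1
  calc logSumExp a μ ≤ μ * (Real.log (Fintype.card ι) + c / μ) := by
        unfold logSumExp; gcongr
    _ = _ := by field_simp; ring

/-- Monotonicity of `ℓᵖ` norms in `p = 1 / μ`, applied to the exponentials of `a`, in logarithmic
form. -/
theorem logSumExp_mono {μ₁ μ₂ : ℝ} (hμ : 0 < μ₂) (h : μ₂ ≤ μ₁) :
    logSumExp a μ₂ ≤ logSumExp a μ₁ := by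
  have hμ₁ := hμ.trans_le h
  rw [logSumExp_le_iff a hμ]
  refine le_trans ?_ ((logSumExp_le_iff a hμ₁ _).mp le_rfl)
  refine Finset.sum_le_sum fun i _ => Real.exp_le_exp.mpr ?_
  -- the numerator is nonpositive, so a smaller denominator decreases the quotient
  have h1 : 0 ≤ logSumExp a μ₁ - a i := sub_nonneg.mpr (le_logSumExp a hμ₁ i)
  have h2 : (logSumExp a μ₁ - a i) / μ₁ ≤ (logSumExp a μ₁ - a i) / μ₂ := by gcongr
  rw [← neg_sub, neg_div, neg_div]
  exact neg_le_neg h2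

/-- Power mean inequality for the exponentials of `a`, in logarithmic form. -/
theorem logSumExp_sub_log_card_anti {μ₁ μ₂ : ℝ} (hμ : 0 < μ₂) (h : μ₂ ≤ μ₁) :
    logSumExp a μ₁ - μ₁ * Real.log (Fintype.card ι) ≤
      logSumExp a μ₂ - μ₂ * Real.log (Fintype.card ι) := by
  have hμ₁ := hμ.trans_le h
  have hn : (0 : ℝ) < Fintype.card ι := by positivity
  set g := logSumExp a μ₁ - μ₁ * Real.log (Fintype.card ι) with hg
  have h1 : ∑ i, Real.exp ((a i - g) / μ₁) = Fintype.card ι := by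
    rw [hg, sum_exp_sub_logSumExp_div a hμ₁, mul_div_cancel_left₀ _ hμ₁.ne', Real.exp_log hn]
  -- Bernoulli's inequality with exponent `μ₁ / μ₂` at each term
  have hb (i : ι) : 1 + μ₁ / μ₂ * (Real.exp ((a i - g) / μ₁) - 1) ≤
      Real.exp ((a i - g) / μ₂) := by
    have := one_add_mul_self_le_rpow_one_add (s := Real.exp ((a i - g) / μ₁) - 1)
      (by linarith [Real.exp_pos ((a i - g) / μ₁)]) ((one_le_div hμ).mpr h)
    rw [add_sub_cancel, ← Real.exp_mul] at this
    convert! this using 2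
    field_simp
  have h2 : (Fintype.card ι : ℝ) ≤ ∑ i, Real.exp ((a i - g) / μ₂) := by
    calc (Fintype.card ι : ℝ) = ∑ i, (1 + μ₁ / μ₂ * (Real.exp ((a i - g) / μ₁) - 1)) := by
          rw [Finset.sum_add_distrib, ← Finset.mul_sum, Finset.sum_sub_distrib, h1]
          simp
      _ ≤ _ := Finset.sum_le_sum fun i _ => hb i
  have h3 := sum_exp_sub_logSumExp_div a hμ (logSumExp a μ₂ - g)
  rw [sub_sub_cancel] at h3
  rw [h3, ← Real.exp_log hn, Real.exp_le_exp, le_div_iff₀ hμ] at h2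
  linarith

end LogSumExp

/-! ### Symmetric functions of the sorted eigenvalues -/

section SortedEigenvalue

variable {n : ℕ} {A : Matrix (Fin n) (Fin n) ℝ} (hA : A.IsHermitian)

theorem sortedEigenvalue_antitone : Antitone (sortedEigenvalue hA) := fun _ _ hij =>
  hA.eigenvalues₀_antitone hij

theorem sum_sortedEigenvalue (f : ℝ → ℝ) :
    ∑ i, f (sortedEigenvalue hA i) = ∑ i, f (hA.eigenvalues i) := by
  have h1 : ∑ i, f (sortedEigenvalue hA i) = ∑ k, f (hA.eigenvalues₀ k) :=
    Equiv.sum_comp (finCongr (Fintype.card_fin n).symm) fun k => f (hA.eigenvalues₀ k)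
  have h2 : ∑ i, f (hA.eigenvalues i) = ∑ k, f (hA.eigenvalues₀ k) :=
    Equiv.sum_comp (Fintype.equivOfCardEq (Fintype.card_fin _)).symm
      fun k => f (hA.eigenvalues₀ k)
  rw [h1, h2]

theorem logSumExp_sortedEigenvalue (μ : ℝ) :
    logSumExp (sortedEigenvalue hA) μ = μ * (μ⁻¹ • A).logTraceExp := by
  rw [logSumExp, sum_sortedEigenvalue hA (fun t => Real.exp (t / μ)), Matrix.logTraceExp,
    hA.trace_exp_smul]
  simp_rw [div_eq_inv_mul]

end SortedEigenvalue

/-! ### Matrix convexity of inversion -/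

namespace Matrix.PosDef

variable {ι : Type*} [Fintype ι] [DecidableEq ι]

/-- The variational lower bound for the quadratic form of `K⁻¹`, obtained by completing the
square. -/
theorem two_mul_dotProduct_sub_le {K : Matrix ι ι ℝ} (hK : K.PosDef) (v w : ι → ℝ) :
    2 * (v ⬝ᵥ w) - w ⬝ᵥ K *ᵥ w ≤ v ⬝ᵥ K⁻¹ *ᵥ v := by
  have hdet : IsUnit K.det := hK.det_pos.ne'.isUnit
  have h := hK.posSemidef.dotProduct_mulVec_nonneg (w - K⁻¹ *ᵥ v)
  have hT : Kᵀ = K := hK.isHermitian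
  have e1 : K *ᵥ (K⁻¹ *ᵥ v) = v := by rw [mulVec_mulVec, mul_nonsing_inv _ hdet, one_mulVec]
  have e2 : (K⁻¹ *ᵥ v) ⬝ᵥ K *ᵥ w = v ⬝ᵥ w := by
    rw [dotProduct_mulVec, ← mulVec_transpose, hT, e1]
  rw [star_trivial, mulVec_sub, e1, sub_dotProduct, dotProduct_sub, dotProduct_sub, e2,
    dotProduct_comm w v, dotProduct_comm (K⁻¹ *ᵥ v) v] at h
  linarith

theorem dotProduct_inv_mulVec {K : Matrix ι ι ℝ} (hK : K.PosDef) (v : ι → ℝ) :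
    2 * (v ⬝ᵥ K⁻¹ *ᵥ v) - (K⁻¹ *ᵥ v) ⬝ᵥ K *ᵥ (K⁻¹ *ᵥ v) = v ⬝ᵥ K⁻¹ *ᵥ v := by
  have hdet : IsUnit K.det := hK.det_pos.ne'.isUnit
  rw [mulVec_mulVec v K, mul_nonsing_inv _ hdet, one_mulVec, dotProduct_comm (K⁻¹ *ᵥ v) v]
  ring

/-- Matrix convexity of inversion on positive definite matrices: the quadratic form of the inverse
is a supremum of functions that are affine in the matrix. -/
theorem posSemidef_convexCombo_inv_sub {K₁ K₂ : Matrix ι ι ℝ} (h₁ : K₁.PosDef) (h₂ : K₂.PosDef)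
    {a b : ℝ} (ha : 0 ≤ a) (hb : 0 ≤ b) (h : (a • K₁ + b • K₂).PosDef) (hab : a + b = 1) :
    (a • K₁⁻¹ + b • K₂⁻¹ - (a • K₁ + b • K₂)⁻¹).PosSemidef := by
  refine PosSemidef.of_dotProduct_mulVec_nonneg
    (((h₁.inv.isHermitian.smul (star_trivial a)).add
      (h₂.inv.isHermitian.smul (star_trivial b))).sub h.inv.isHermitian) fun v => ?_
  rw [star_trivial]
  set w := (a • K₁ + b • K₂)⁻¹ *ᵥ v with hw
  have e := h.dotProduct_inv_mulVec v
  rw [← hw] at e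
  have i1 := mul_le_mul_of_nonneg_left (h₁.two_mul_dotProduct_sub_le v w) ha
  have i2 := mul_le_mul_of_nonneg_left (h₂.two_mul_dotProduct_sub_le v w) hb
  simp only [sub_mulVec, add_mulVec, smul_mulVec, dotProduct_sub, dotProduct_add,
    dotProduct_smul, smul_eq_mul] at e ⊢
  rw [← hw]
  have : (a + b) * (v ⬝ᵥ w) = v ⬝ᵥ w := by rw [hab, one_mul]
  nlinarith

end Matrix.PosDef

/-! ### The feasible set and the compliance matrix -/

namespace RobustTruss

variable {m d n : ℕ} (T : RobustTruss m d n)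

theorem pos_of_mem_feasibleSet {x : EuclideanSpace ℝ (Fin m)} (hx : x ∈ T.feasibleSet)
    (j : Fin m) : 0 < x j := T.minArea_pos.trans_le (hx.2 j)

theorem stiffness_posDef {x : EuclideanSpace ℝ (Fin m)} (hx : ∀ j, 0 < x j) :
    (T.stiffness x).PosDef := T.posDef_of_pos _ hx

theorem isClosed_feasibleSet : IsClosed T.feasibleSet := by
  have h : Continuous fun x : EuclideanSpace ℝ (Fin m) => ∑ j, T.length j * x j := by fun_prop
  have e : T.feasibleSet = {x | ∑ j, T.length j * x j ≤ T.maxVolume} ∩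
      ⋂ j, {x | T.minArea ≤ x j} := by
    ext x
    simp [feasibleSet]
  rw [e]
  exact (isClosed_le h continuous_const).inter
    (isClosed_iInter fun j => isClosed_le continuous_const (by fun_prop))

theorem isCompact_feasibleSet : IsCompact T.feasibleSet := by
  let B : Set (Fin m → ℝ) := Set.Icc 0 fun j => T.maxVolume / T.length j
  have hB : IsCompact ((EuclideanSpace.equiv (Fin m) ℝ).symm '' B) :=
    isCompact_Icc.image (EuclideanSpace.equiv (Fin m) ℝ).symm.continuous
  refine hB.of_isClosed_subset T.isClosed_feasibleSet fun x hx => ?_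
  refine ⟨EuclideanSpace.equiv (Fin m) ℝ x, ⟨fun j => (T.pos_of_mem_feasibleSet hx j).le,
    fun j => ?_⟩, by simp⟩
  change x j ≤ _
  rw [le_div_iff₀ (T.length_pos j), mul_comm]
  exact (Finset.single_le_sum (f := fun j => T.length j * x j)
    (fun k _ => (mul_pos (T.length_pos k) (T.pos_of_mem_feasibleSet hx k)).le)
    (Finset.mem_univ j)).trans hx.1

theorem convex_feasibleSet : Convex ℝ T.feasibleSet := by
  intro x hx y hy a b ha hb hab
  refine ⟨?_, fun j => ?_⟩
  · have e : ∑ j, T.length j * (a • x + b • y) j =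
        a * ∑ j, T.length j * x j + b * ∑ j, T.length j * y j := by
      rw [Finset.mul_sum, Finset.mul_sum, ← Finset.sum_add_distrib]
      refine Finset.sum_congr rfl fun j _ => ?_
      simp only [PiLp.add_apply, PiLp.smul_apply, smul_eq_mul]
      ring
    rw [e]
    calc _ ≤ a * T.maxVolume + b * T.maxVolume :=
          add_le_add (mul_le_mul_of_nonneg_left hx.1 ha) (mul_le_mul_of_nonneg_left hy.1 hb)
      _ = _ := by rw [← add_mul, hab, one_mul]
  · simp only [PiLp.add_apply, PiLp.smul_apply, smul_eq_mul]
    calc T.minArea = a * T.minArea + b * T.minArea := by rw [← add_mul, hab, one_mul]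
      _ ≤ _ := add_le_add (mul_le_mul_of_nonneg_left (hx.2 j) ha)
        (mul_le_mul_of_nonneg_left (hy.2 j) hb)

theorem stiffness_combo (x y : EuclideanSpace ℝ (Fin m)) (a b : ℝ) :
    T.stiffness (a • x + b • y) = a • T.stiffness x + b • T.stiffness y := by
  simp only [stiffness, Finset.smul_sum, ← Finset.sum_add_distrib, smul_smul, ← add_smul]
  rfl

theorem posSemidef_combo_complianceMatrix_sub {x y : EuclideanSpace ℝ (Fin m)}
    (hx : x ∈ T.feasibleSet) (hy : y ∈ T.feasibleSet) {a b : ℝ} (ha : 0 ≤ a) (hb : 0 ≤ b)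
    (hab : a + b = 1) :
    (a • T.complianceMatrix x + b • T.complianceMatrix y -
      T.complianceMatrix (a • x + b • y)).PosSemidef := by
  have hz := T.stiffness_posDef (T.pos_of_mem_feasibleSet
    (T.convex_feasibleSet hx hy ha hb hab))
  rw [stiffness_combo] at hz
  have h := ((T.stiffness_posDef (T.pos_of_mem_feasibleSet hx)).posSemidef_convexCombo_inv_sub
    (T.stiffness_posDef (T.pos_of_mem_feasibleSet hy)) ha hb hz hab).conjTranspose_mul_mul_same
    T.load
  rw [Matrix.conjTranspose_eq_transpose_of_trivial] at h
  simpa only [complianceMatrix, stiffness_combo, Matrix.mul_sub, Matrix.sub_mul, Matrix.mul_add,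
    Matrix.add_mul, Matrix.mul_smul, Matrix.smul_mul] using h

theorem contDiffAt_complianceMatrix {x : EuclideanSpace ℝ (Fin m)} (hx : ∀ j, 0 < x j)
    {k : WithTop ℕ∞} : ContDiffAt ℝ k T.complianceMatrix x := by
  have h1 : ContDiff ℝ k T.stiffness := by
    unfold stiffness
    fun_prop
  have h2 : ContDiffAt ℝ k (fun y => (T.stiffness y)⁻¹) x := by
    simp_rw [Matrix.nonsing_inv_eq_ringInverse]
    obtain ⟨u, hu⟩ := (T.stiffness_posDef hx).isUnit
    have := contDiffAt_ringInverse ℝ (n := k) u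
    rw [hu] at this
    exact this.comp x h1.contDiffAt
  let Φ : Matrix (Fin d) (Fin d) ℝ →ₗ[ℝ] Matrix (Fin n) (Fin n) ℝ :=
    { toFun := fun M => T.loadᵀ * M * T.load
      map_add' := fun M N => by rw [Matrix.mul_add, Matrix.add_mul]
      map_smul' := fun c M => by simp }
  exact (LinearMap.toContinuousLinearMap Φ).contDiff.contDiffAt.comp x h2

theorem isHermitian_inv_smul_complianceMatrix (μ : ℝ) (x : EuclideanSpace ℝ (Fin m)) :
    (μ⁻¹ • T.complianceMatrix x).IsHermitian :=
  (T.complianceMatrix_isHermitian x).smul (star_trivial _)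

/-! ### The smoothing and the objective -/

section Smoothing

variable [NeZero n]

theorem smoothing_zero (x : EuclideanSpace ℝ (Fin m)) : T.smoothing 0 x = T.objective x :=
  if_pos rfl

theorem smoothing_eq_logSumExp {μ : ℝ} (hμ : 0 < μ) (x : EuclideanSpace ℝ (Fin m)) :
    T.smoothing μ x =
      logSumExp (sortedEigenvalue (T.complianceMatrix_isHermitian x)) μ - μ * Real.log n :=
  if_neg hμ.ne'

theorem smoothing_eq_logTraceExp {μ : ℝ} (hμ : 0 < μ) (x : EuclideanSpace ℝ (Fin m)) :
    T.smoothing μ x = μ * (μ⁻¹ • T.complianceMatrix x).logTraceExp - μ * Real.log n := by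
  rw [T.smoothing_eq_logSumExp hμ, logSumExp_sortedEigenvalue]

theorem smoothing_sub_bounds (x : EuclideanSpace ℝ (Fin m)) {μ₁ μ₂ : ℝ} (h : μ₂ ≤ μ₁)
    (h₂ : 0 ≤ μ₂) :
    0 ≤ T.smoothing μ₂ x - T.smoothing μ₁ x ∧
      T.smoothing μ₂ x - T.smoothing μ₁ x ≤ Real.log n * (μ₁ - μ₂) := by
  set a := sortedEigenvalue (T.complianceMatrix_isHermitian x) with ha
  rcases h₂.eq_or_lt with rfl | hpos
  · rcases h.eq_or_lt with rfl | h₁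
    · simp
    · have u := logSumExp_le_add_log_card a h₁ (c := T.objective x)
        fun i => sortedEigenvalue_antitone _ (Fin.zero_le i)
      have l : T.objective x ≤ _ := le_logSumExp a h₁ 0
      rw [Fintype.card_fin] at u
      rw [smoothing_zero, T.smoothing_eq_logSumExp h₁, ← ha]
      constructor <;> linarith
  · have u := logSumExp_mono a hpos h
    have l := logSumExp_sub_log_card_anti a hpos h
    rw [Fintype.card_fin] at l
    rw [T.smoothing_eq_logSumExp hpos, T.smoothing_eq_logSumExp (hpos.trans_le h), ← ha]
    constructor <;> linarith

/-- The subgradient inequality for `logTraceExp`, along the compliance matrix. -/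
theorem smoothing_add_trace_le {μ : ℝ} (hμ : 0 < μ) (x y : EuclideanSpace ℝ (Fin m)) :
    T.smoothing μ x + ((μ⁻¹ • T.complianceMatrix x).gibbs *
      (T.complianceMatrix y - T.complianceMatrix x)).trace ≤ T.smoothing μ y := by
  have h := mul_le_mul_of_nonneg_left
    ((T.isHermitian_inv_smul_complianceMatrix μ x).logTraceExp_add_trace_gibbs_mul_le
      (T.isHermitian_inv_smul_complianceMatrix μ y)) hμ.le
  rw [← smul_sub, mul_smul_comm, Matrix.trace_smul, smul_eq_mul, mul_add,
    mul_inv_cancel_left₀ hμ.ne'] at h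
  rw [T.smoothing_eq_logTraceExp hμ, T.smoothing_eq_logTraceExp hμ]
  linarith

/-- The Gibbs state at the intermediate point supports `f_μ` there; it is positive semidefinite, so
its pairing preserves the matrix convexity of `A`. -/
theorem convexOn_smoothing {μ : ℝ} (hμ : 0 < μ) :
    ConvexOn ℝ T.feasibleSet (T.smoothing μ) := by
  refine ⟨T.convex_feasibleSet, fun x hx y hy a b ha hb hab => ?_⟩
  set z := a • x + b • y
  have h1 := mul_le_mul_of_nonneg_left (T.smoothing_add_trace_le hμ z x) ha
  have h2 := mul_le_mul_of_nonneg_left (T.smoothing_add_trace_le hμ z y) hb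
  have h3 := (T.isHermitian_inv_smul_complianceMatrix μ z).trace_gibbs_mul_nonneg
    (T.posSemidef_combo_complianceMatrix_sub hx hy ha hb hab)
  simp only [Matrix.mul_sub, Matrix.mul_add, Matrix.mul_smul, Matrix.trace_sub,
    Matrix.trace_add, Matrix.trace_smul, smul_eq_mul] at h1 h2 h3 ⊢
  have hb' : b = 1 - a := by linarith
  subst hb'
  linarith

theorem contDiffAt_smoothing {μ : ℝ} (hμ : 0 < μ) {x : EuclideanSpace ℝ (Fin m)}
    (hx : ∀ j, 0 < x j) {k : WithTop ℕ∞} : ContDiffAt ℝ k (T.smoothing μ) x := by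
  rw [funext (T.smoothing_eq_logTraceExp hμ)]
  have h : ContDiffAt ℝ k (fun y => (μ⁻¹ • T.complianceMatrix y).logTraceExp) x :=
    ContDiffAt.comp (g := Matrix.logTraceExp) x
      (Matrix.contDiffAt_logTraceExp (T.isHermitian_inv_smul_complianceMatrix μ x))
      ((T.contDiffAt_complianceMatrix hx).const_smul μ⁻¹)
  exact (contDiffAt_const.mul h).sub contDiffAt_const

/-- The derivative of the smoothing at `x` is `h ↦ tr (ρ A'(x) h)` with the Gibbs state `ρ` of
`A(x) / μ`: by the subgradient inequality, `y ↦ f_μ(y) - tr (ρ A(y))` is minimal at `y = x`. -/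
theorem fderiv_smoothing_apply {μ : ℝ} (hμ : 0 < μ) {x : EuclideanSpace ℝ (Fin m)}
    (hx : ∀ j, 0 < x j) (h : EuclideanSpace ℝ (Fin m)) :
    fderiv ℝ (T.smoothing μ) x h =
      ((μ⁻¹ • T.complianceMatrix x).gibbs * fderiv ℝ T.complianceMatrix x h).trace := by
  set ρ := (μ⁻¹ • T.complianceMatrix x).gibbs with hρ
  let Φ : Matrix (Fin n) (Fin n) ℝ →L[ℝ] ℝ :=
    (Matrix.traceCLM (Fin n)).comp (ContinuousLinearMap.mul ℝ _ ρ)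
  have hf := ((T.contDiffAt_smoothing hμ hx (k := 1)).differentiableAt one_ne_zero).hasFDerivAt
  have hA := ((T.contDiffAt_complianceMatrix hx (k := 1)).differentiableAt
    one_ne_zero).hasFDerivAt
  have hd := hf.sub (Φ.hasFDerivAt.comp x hA)
  have hmin : IsLocalMin (T.smoothing μ - Φ ∘ T.complianceMatrix) x := by
    refine Filter.Eventually.of_forall fun y => ?_
    have := T.smoothing_add_trace_le hμ x y
    rw [← hρ, mul_sub, Matrix.trace_sub] at this
    change T.smoothing μ x - (ρ * T.complianceMatrix x).trace ≤
      T.smoothing μ y - (ρ * T.complianceMatrix y).trace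
    linarith
  have h0 := DFunLike.congr_fun (hmin.hasFDerivAt_eq_zero hd) h
  exact sub_eq_zero.mp h0

/-- The gradient is the pairing of the Gibbs state of `A(x) / μ`, which is bounded by one and
`O(1 / μ)`-Lipschitz in `x`, with `A'(x)`, which is bounded and Lipschitz on the feasible set. The
two factors contribute the terms `L / μ` and `L'`. -/
theorem exists_lipschitz_gradient_smoothing :
    ∃ L L' : ℝ, 0 < L ∧ 0 < L' ∧ ∀ μ : ℝ, 0 < μ →
      ∀ x ∈ T.feasibleSet, ∀ y ∈ T.feasibleSet,
        ‖∇ (T.smoothing μ) x - ∇ (T.smoothing μ) y‖ ≤ (L' + L / μ) * ‖x - y‖ := by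
  have hAx {x} (hx : x ∈ T.feasibleSet) :=
    T.contDiffAt_complianceMatrix (T.pos_of_mem_feasibleSet hx) (k := 2)
  obtain ⟨C, hC⟩ := ContDiffOn.exists_lipschitzOnWith
    (fun x hx => (hAx hx).contDiffWithinAt) two_ne_zero T.convex_feasibleSet
    T.isCompact_feasibleSet
  obtain ⟨D, hD⟩ := ContDiffOn.exists_lipschitzOnWith
    (fun x hx => ((hAx hx).fderiv_right (m := 1) (by norm_num)).contDiffWithinAt) one_ne_zero
    T.convex_feasibleSet T.isCompact_feasibleSet
  obtain ⟨B, hB⟩ := T.isCompact_feasibleSet.exists_bound_of_continuousOn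
    (f := fderiv ℝ T.complianceMatrix) hD.continuousOn
  set τ := ‖Matrix.traceCLM (Fin n)‖
  have hτ : 0 ≤ τ := norm_nonneg (Matrix.traceCLM (Fin n))
  -- the summands `1` make the constants positive even if `A` is constant
  refine ⟨τ * (1 + τ) * C * |B| + 1, τ * D + 1, by positivity, by positivity,
    fun μ hμ x hx y hy => ?_⟩
  have hgrad : ‖∇ (T.smoothing μ) x - ∇ (T.smoothing μ) y‖ =
      ‖fderiv ℝ (T.smoothing μ) x - fderiv ℝ (T.smoothing μ) y‖ := by
    rw [gradient, gradient, ← map_sub, LinearIsometryEquiv.norm_map]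
  rw [hgrad]
  refine ContinuousLinearMap.opNorm_le_bound _ (by positivity) fun h => ?_
  set ρx := (μ⁻¹ • T.complianceMatrix x).gibbs
  set ρy := (μ⁻¹ • T.complianceMatrix y).gibbs
  set Ax := fderiv ℝ T.complianceMatrix x
  set Ay := fderiv ℝ T.complianceMatrix y
  have hsplit : (fderiv ℝ (T.smoothing μ) x - fderiv ℝ (T.smoothing μ) y) h =
      ((ρx - ρy) * Ax h).trace + (ρy * (Ax - Ay) h).trace := by
    rw [sub_apply,
      T.fderiv_smoothing_apply hμ (T.pos_of_mem_feasibleSet hx),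
      T.fderiv_smoothing_apply hμ (T.pos_of_mem_feasibleSet hy), sub_apply,
      sub_mul, mul_sub, Matrix.trace_sub, Matrix.trace_sub]
    ring
  have hρ : ‖ρx - ρy‖ ≤ (1 + τ) * (μ⁻¹ * (C * ‖x - y‖)) := by
    refine ((T.isHermitian_inv_smul_complianceMatrix μ y).norm_gibbs_sub_gibbs_le
      (T.isHermitian_inv_smul_complianceMatrix μ x)).trans ?_
    rw [← smul_sub, norm_smul, Real.norm_of_nonneg (inv_nonneg.mpr hμ.le)]
    gcongr
    exact hC.norm_sub_le hx hy
  have hρy : ‖ρy‖ ≤ 1 := (T.isHermitian_inv_smul_complianceMatrix μ y).norm_gibbs_le_one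
  have hAx' : ‖Ax h‖ ≤ |B| * ‖h‖ :=
    (Ax.le_opNorm h).trans (by gcongr; exact (hB x hx).trans (le_abs_self B))
  have hAy' : ‖(Ax - Ay) h‖ ≤ D * ‖x - y‖ * ‖h‖ :=
    ((Ax - Ay).le_opNorm h).trans (by gcongr; exact hD.norm_sub_le hx hy)
  rw [hsplit]
  calc ‖((ρx - ρy) * Ax h).trace + (ρy * (Ax - Ay) h).trace‖
      ≤ |((ρx - ρy) * Ax h).trace| + |(ρy * (Ax - Ay) h).trace| := norm_add_le _ _
    _ ≤ τ * ‖ρx - ρy‖ * ‖Ax h‖ + τ * ‖ρy‖ * ‖(Ax - Ay) h‖ :=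
        add_le_add (Matrix.abs_trace_mul_le _ _) (Matrix.abs_trace_mul_le _ _)
    _ ≤ τ * ((1 + τ) * (μ⁻¹ * (C * ‖x - y‖))) * (|B| * ‖h‖) +
        τ * 1 * (D * ‖x - y‖ * ‖h‖) := by gcongr
    _ = (τ * D + τ * (1 + τ) * C * |B| / μ) * ‖x - y‖ * ‖h‖ := by
        rw [div_eq_mul_inv]; ring
    _ ≤ _ := by gcongr <;> linarith

/-- The objective is within `μ log n` above the convex function `f_μ`; let `μ → 0`. -/
theorem convexOn_objective : ConvexOn ℝ T.feasibleSet T.objective := by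
  refine ⟨T.convex_feasibleSet, fun x hx y hy a b ha hb hab => ?_⟩
  have key (μ : ℝ) (hμ : 0 < μ) : T.objective (a • x + b • y) ≤
      a • T.objective x + b • T.objective y + Real.log n * μ := by
    have h1 := (T.convexOn_smoothing hμ).2 hx hy ha hb hab
    have h2 := (T.smoothing_sub_bounds (a • x + b • y) hμ.le le_rfl).2
    have h3 := mul_le_mul_of_nonneg_left (T.smoothing_sub_bounds x hμ.le le_rfl).1 ha
    have h4 := mul_le_mul_of_nonneg_left (T.smoothing_sub_bounds y hμ.le le_rfl).1 hb
    rw [smoothing_zero] at h2 h3 h4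
    simp only [smul_eq_mul] at h1 ⊢
    linarith
  have hlim : Filter.Tendsto
      (fun μ => a • T.objective x + b • T.objective y + Real.log n * μ)
      (nhdsWithin 0 (Set.Ioi 0)) (nhds (a • T.objective x + b • T.objective y)) := by
    have : Continuous
        fun μ => a • T.objective x + b • T.objective y + Real.log n * μ := by fun_prop
    simpa using (this.tendsto 0).mono_left nhdsWithin_le_nhds
  exact ge_of_tendsto hlim (Filter.eventually_of_mem self_mem_nhdsWithin key)

theorem continuousOn_objective : ContinuousOn T.objective T.feasibleSet := by
  have h : TendstoUniformlyOn T.smoothing T.objective (nhdsWithin 0 (Set.Ioi 0))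
      T.feasibleSet := by
    rw [Metric.tendstoUniformlyOn_iff]
    intro ε hε
    have hlim : Filter.Tendsto (fun μ : ℝ => Real.log n * μ) (nhdsWithin 0 (Set.Ioi 0))
        (nhds 0) := by
      have : Continuous fun μ : ℝ => Real.log n * μ := by fun_prop
      simpa using (this.tendsto 0).mono_left nhdsWithin_le_nhds
    filter_upwards [hlim.eventually_lt_const hε, self_mem_nhdsWithin] with μ h1 hμ x _
    have h2 := T.smoothing_sub_bounds x (le_of_lt hμ) le_rfl
    rw [smoothing_zero, sub_zero] at h2
    rw [Real.dist_eq, abs_of_nonneg h2.1]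
    linarith
  refine h.continuousOn (Filter.Eventually.frequently ?_)
  filter_upwards [self_mem_nhdsWithin] with μ hμ x hx
  exact (T.contDiffAt_smoothing hμ (T.pos_of_mem_feasibleSet hx)
    (k := 0)).continuousAt.continuousWithinAt

end Smoothing

end RobustTruss

end

theorem mainTheorem2 {m d n : ℕ} [NeZero n] (T : RobustTruss m d n) :
    IsCompact T.feasibleSet ∧
    (∀ μ : ℝ, 0 < μ → ConvexOn ℝ T.feasibleSet (T.smoothing μ)) ∧
    (∀ μ : ℝ, 0 < μ → ∀ x ∈ T.feasibleSet, ContDiffAt ℝ 1 (T.smoothing μ) x) ∧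
    (∃ L L' : ℝ, 0 < L ∧ 0 < L' ∧ ∀ μ : ℝ, 0 < μ →
      ∀ x ∈ T.feasibleSet, ∀ y ∈ T.feasibleSet,
        ‖∇ (T.smoothing μ) x - ∇ (T.smoothing μ) y‖ ≤ (L' + L / μ) * ‖x - y‖) ∧
    (∀ x ∈ T.feasibleSet, ∀ μ₁ μ₂ : ℝ, μ₂ ≤ μ₁ → 0 ≤ μ₂ →
      0 ≤ T.smoothing μ₂ x - T.smoothing μ₁ x ∧
        T.smoothing μ₂ x - T.smoothing μ₁ x ≤ Real.log n * (μ₁ - μ₂)) ∧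
    (T.feasibleSet.Nonempty → ∀ β : ℝ, 0 < β → Real.log n ≤ β →
      SmoothingAssumption T.feasibleSet T.objective T.smoothing β) := by
  have hdiff (μ : ℝ) (hμ : 0 < μ) (x) (hx : x ∈ T.feasibleSet) :
      ContDiffAt ℝ 1 (T.smoothing μ) x :=
    T.contDiffAt_smoothing hμ (T.pos_of_mem_feasibleSet hx)
  obtain ⟨L, L', hL, hL', hlip⟩ := T.exists_lipschitz_gradient_smoothing
  refine ⟨T.isCompact_feasibleSet, fun μ hμ => T.convexOn_smoothing hμ, hdiff,
    ⟨L, L', hL, hL', hlip⟩, fun x _ μ₁ μ₂ h h₂ => T.smoothing_sub_bounds x h h₂,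
    fun hne β hβ hlog => ?_⟩
  exact
    { nonempty := hne
      isClosed := T.isClosed_feasibleSet
      convex := T.convex_feasibleSet
      convexOn := T.convexOn_objective
      exists_optimal := T.isCompact_feasibleSet.exists_isMinOn hne T.continuousOn_objective
      approx_zero := fun x _ => T.smoothing_zero x
      approx_convexOn := fun μ hμ => T.convexOn_smoothing hμ
      approx_contDiffAt := hdiff
      approx_lipschitz := ⟨L, L', hL, hL'.le, hlip⟩
      bound_pos := hβ
      approx_bound := fun x _ μ₁ μ₂ h h₂ =>
        ⟨(T.smoothing_sub_bounds x h h₂).1, (T.smoothing_sub_bounds x h h₂).2.trans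
          (mul_le_mul_of_nonneg_right hlog (sub_nonneg.mpr h))⟩ }
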